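/- Let $S$ be the set of finite binary strings, $\Omega=\{0,1\}^{\mathbb N}$, and $\sqsubseteq$ the prefix order on $S\cup\Omega$. For $x,y\in S$ let $\Delta(x,y)\subset\Omega^2$ be the set of pairs $(u,v)$ with $x\sqsubset u$, $y\sqsubset v$. Let $P$ be a computable probability on $\Omega^2$, i.e. the numbers $P(x,y):=P(\Delta(x,y))$ are uniformly computable reals. Put $P_X(x)=P(x,\lambda)$ ($\lambda$ the empty string), $P(y|x)=P(x,y)/P_X(x)$ if $P_X(x)>0$ and $P(y|x)=0$ otherwise, and, for $x^\infty\in\Omega$, $P(y|x^\infty)=\lim_{x\to x^\infty}P(y|x)$, the limit being along the prefixes $x$ of $x^\infty$, if it exists. Let $\mathcal R^P\subset\Omega^2$ be the set of Martin-Löf random pairs, i.e. the complement of $\bigcap_n\tilde U_n$, where $U$ is a universal Martin-Löf test with respect to $P$ and $\tilde U_n$ is the union of the $\Delta(x,y)$ with $(n,x,y)\in U$. A function $\rho:S\cup\Omega\to S\cup\Omega$ is a computable monotone function if there is a recursively enumerable $F\subset S\times S$ such that, with $F_p=\{x:(p,x)\in F\}$, for every $p\in S$ we have $\lambda\in F_p$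 and $\bigvee_{p'\sqsubseteq p}F_{p'}$ exists, and $\rho(p)=\bigvee_{p'\sqsubseteq p,\,p'\in S}F_{p'}$ for all $p\in S\cup\Omega$. Let $h:\mathbb N\to\mathbb N$ be a computable increasing function ($n\le m\Rightarrow h(n)\le h(m)$) and $\mathcal A=\{(x,y)\in S^2:|x|=h(|y|)\}$. For $(x^\infty,y^\infty)\in\Omega^2$ let $\mathcal A(x^\infty,y^\infty)$ be the set of $(x,y)\in\mathcal A$ with $x\sqsubset x^\infty$ and $y\sqsubset y^\infty$. Then for each $(x^\infty,y^\infty)\in\Omega^2$: (a) If $h$ is unbounded and $\inf_{(x,y)\in\mathcal A(x^\infty,y^\infty)}P(y|x)>0$, then there is a partial computable function $\rho$ from $S$ to $S$ (not necessarily monotone) such that $\rho(x)$ is defined and $y=\rho(x)$ for infinitely many $(x,y)\in\mathcal A(x^\infty,y^\infty)$. (b) Let $f:\mathbb N\to\{q\in\mathbb Q:0<q<1\}$ with $\sum_nf(n)<\infty$. Assume that $(x^\infty,y^\infty)\in\mathcal R^P$ and that $P(\cdot|x^\infty)$ effectively converges for $f$ with rate $h$, i.e. for all $(x,y)\in\mathcal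 A(x^\infty,y^\infty)$ the limit $P(y|x^\infty)$ exists, is nonzero, and $$\Bigl|\frac{P(y|x)}{P(y|x^\infty)}-1\Bigr|<f(|y|).$$ If $\inf_{(x,y)\in\mathcal A(x^\infty,y^\infty)}P(y|x)>0$, then there is a computable monotone function $\rho$ such that $y\sqsubseteq\rho(x)$ for all $(x,y)\in\mathcal A(x^\infty,y^\infty)$. (c) If $(x^\infty,y^\infty)\in\mathcal R^P$ and $\inf_{(x,y)\in\mathcal A(x^\infty,y^\infty)}P(y|x)=0$, then there is no computable monotone function $\rho$ such that $y\sqsubseteq\rho(x)$ for all $(x,y)\in\mathcal A(x^\infty,y^\infty)$. -/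

import Mathlib

namespace AlgRand

open MeasureTheory Filter Topology

/-- Infinite binary sequences, with the product topology and product sigma-algebra. -/
abbrev Seq : Type := ℕ → Bool

/-- Finite binary strings. -/
abbrev Word : Type := List Bool

/-- `x` is a (finite) prefix of the infinite sequence `w`. -/
def IsPrefixOf (x : Word) (w : Seq) : Prop := ∀ i (hi : i < x.length), x[i] = w i

/-- The prefix of length `n` of an infinite sequence. -/
def initSeg (w : Seq) (n : ℕ) : Word := List.ofFn fun i : Fin n => w i

/-- The cylinder of all infinite sequences that extend `x`. -/
def cyl (x : Word) : Set Seq := {w | IsPrefixOf x w}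

/-- The rectangle `Δ(x, y)`, the product of the two cylinders. -/
def cyl₂ (x y : Word) : Set (Seq × Seq) := cyl x ×ˢ cyl y

/-! ### Computable probabilities, tests and random pairs -/

/-- `P(Δ(x, y))` is approximated within `1 / k` by the rational number `a / b`, where the numerator
and the denominator are computed from `x`, `y` and `k`. -/
def IsComputableMeasure (P : Measure (Seq × Seq)) : Prop :=
  ∃ (a : (Word × Word) × ℕ → ℤ) (b : (Word × Word) × ℕ → ℕ),
    Computable a ∧ Computable b ∧ (∀ q, 0 < b q) ∧
    ∀ (x y : Word) (k : ℕ), 0 < k →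
      |P.real (cyl₂ x y) - (a ((x, y), k) : ℝ) / (b ((x, y), k) : ℝ)| < 1 / (k : ℝ)

/-- The open set covered by the `n`-th section of `U`. -/
def covered (U : Set (ℕ × (Word × Word))) (n : ℕ) : Set (Seq × Seq) :=
  {w | ∃ x y : Word, (n, (x, y)) ∈ U ∧ w ∈ cyl₂ x y}

/-- Martin-Löf tests with respect to `P`. -/
structure IsTest (P : Measure (Seq × Seq)) (U : Set (ℕ × (Word × Word))) : Prop where
  re : REPred fun q => q ∈ U
  anti : ∀ n, covered U (n + 1) ⊆ covered U n
  small : ∀ n, P.real (covered U n) < (2 : ℝ)⁻¹ ^ n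

/-- A test which, up to a shift, covers every other test. -/
def IsUniversalTest (P : Measure (Seq × Seq)) (U : Set (ℕ × (Word × Word))) : Prop :=
  IsTest P U ∧ ∀ V, IsTest P V → ∃ c, ∀ n, covered V (n + c) ⊆ covered U n

/-- The set of Martin-Löf random pairs with respect to `P`: the complement of the limit of a
universal test (the limit does not depend on the universal test). -/
def randomSet (P : Measure (Seq × Seq)) : Set (Seq × Seq) :=
  {w | ∃ U, IsUniversalTest P U ∧ w ∉ ⋂ n, covered U n}

/-! ### Conditional probabilities -/

open Classical in
/-- `P(y | x) = P(x, y) / P_X(x)`, and `0` if `P_X(x) = 0`. -/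
noncomputable def condProb (P : Measure (Seq × Seq)) (y x : Word) : ℝ :=
  if 0 < P.real (cyl₂ x []) then P.real (cyl₂ x y) / P.real (cyl₂ x []) else 0

/-- The limit `P(y | w)` of `P(y | x)` along the prefixes `x` of `w` exists and is `L`. -/
def HasCondLimit (P : Measure (Seq × Seq)) (y : Word) (w : Seq) (L : ℝ) : Prop :=
  Tendsto (fun n => condProb P y (initSeg w n)) atTop (𝓝 L)

/-- The set of pairs `(x, y)` with `|x| = h(|y|)`. -/
def matched (h : ℕ → ℕ) : Set (Word × Word) := {q | q.1.length = h q.2.length}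

/-- The pairs in `matched h` that are prefixes of the pair `w` of infinite sequences. -/
def matchedAlong (h : ℕ → ℕ) (w : Seq × Seq) : Set (Word × Word) :=
  {q | q ∈ matched h ∧ IsPrefixOf q.1 w.1 ∧ IsPrefixOf q.2 w.2}

/-- `inf P(y | x)` over the pairs `(x, y)` in `matchedAlong h w` (a nonempty set). -/
noncomputable def infCondProb (P : Measure (Seq × Seq)) (h : ℕ → ℕ) (w : Seq × Seq) : ℝ :=
  sInf ((fun q : Word × Word => condProb P q.2 q.1) '' matchedAlong h w)

/-- `|P(y | x) / P(y | x^∞) - 1| < f(|y|)` for all prefixes `(x, y)` of `w = (x^∞, y^∞)` with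
`|x| = h(|y|)`; here `P(y | x^∞)` is the limit of `P(y | x)` along the prefixes of `x^∞`, which is
nonzero since it is divided by. -/
def EffectivelyConverges (P : Measure (Seq × Seq)) (f : ℕ → ℚ) (h : ℕ → ℕ) (w : Seq × Seq) : Prop :=
  ∀ q ∈ matchedAlong h w, ∃ L : ℝ, HasCondLimit P q.2 w.1 L ∧ L ≠ 0 ∧
    |condProb P q.2 q.1 / L - 1| < (f q.2.length : ℝ)

/-! ### Monotone functions on finite and infinite strings -/

/-- The set of all finite and infinite binary strings. -/
inductive Str : Type
  | fin (x : Word) : Str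
  | inf (w : Seq) : Str

/-- The prefix relation on finite and infinite strings. -/
def Str.IsPrefix : Str → Str → Prop
  | .fin x, .fin y => x <+: y
  | .fin x, .inf w => IsPrefixOf x w
  | .inf _, .fin _ => False
  | .inf v, .inf w => v = w

instance : PartialOrder Str where
  le := Str.IsPrefix
  le_refl s := by
    cases s with
    | fin x => exact List.prefix_refl x
    | inf w => exact rfl
  le_trans s t u hst htu := by
    cases s with
    | fin x =>
      cases t with
      | fin y =>
        cases u with
        | fin z => exact List.IsPrefix.trans hst htu
        | inf w =>
          intro i hi
          have hxy : x <+: y := hst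
          have hyw : IsPrefixOf y w := htu
          rw [hxy.getElem hi]
          exact hyw i (lt_of_lt_of_le hi hxy.length_le)
      | inf v =>
        cases u with
        | fin z => exact htu.elim
        | inf w =>
          have hvw : v = w := htu
          subst hvw
          exact hst
    | inf v =>
      cases t with
      | fin y => exact hst.elim
      | inf v' =>
        have hvv : v = v' := hst
        subst hvv
        exact htu
  le_antisymm s t hst hts := by
    cases s with
    | fin x =>
      cases t with
      | fin y =>
        have hxy : x <+: y := hst
        have hyx : y <+: x := hts
        rw [hxy.eq_of_length_le hyx.length_le]
      | inf v => exact hts.elim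
    | inf v =>
      cases t with
      | fin y => exact hst.elim
      | inf v' =>
        have hvv : v = v' := hst
        rw [hvv]

/-- `ρ` is the monotone function `ρ(p) = ⋁_{p' ⊑ p} F_{p'}` (with `p'` ranging over finite strings)
given by a recursively enumerable set `F` of pairs of finite strings such that, for each finite
`p`, the empty string lies in `F_p` and the supremum `⋁_{p' ⊑ p} F_{p'}` exists. -/
def IsComputableMonotone (ρ : Str → Str) : Prop :=
  ∃ F : Set (Word × Word),
    REPred (fun q => q ∈ F) ∧
    (∀ p : Word, (p, []) ∈ F ∧
      ∃ s : Str, IsLUB {t : Str | ∃ p' x : Word, p' <+: p ∧ (p', x) ∈ F ∧ t = .fin x} s) ∧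
    ∀ p : Str, IsLUB {t : Str | ∃ p' x : Word, Str.fin p' ≤ p ∧ (p', x) ∈ F ∧ t = .fin x} (ρ p)

end AlgRand

/-! Strict comparison of computable reals is r.e. (`rePred_measure_lt`); each claim rests on an r.e.
condition on `P(y | x)` for matched `x`, `y`.

Infinitely often: if `P(y | x) > i / j` throughout, then for each relevant `x` the strings `y` of
one fixed length passing this test form an r.e. set of at most `j` elements that contains the right
one. Choose an element effectively; if it is right only finitely often, discard it and repeat with a
smaller bound (`exists_partrec_infinite`).

Monotone recovery: the probabilities eventually stay close to a limit `α > 0`, so there are `N` and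
`c` with `P(y | x) > c` and `P(y_N | x) < 2c` from `N` on. Two extensions of `y_N` of equal length
cannot both exceed `c`, so the candidate is unique, and unique r.e. candidates assemble into a
monotone function (`exists_isComputableMonotone_of_unique`).

Impossibility: for monotone `ρ`, the pairs with `y ⊑ ρ(x)` and `P(y | x) < 2^{-(n+1)}` form a test.
Minimal rectangles have disjoint first sides, because values of `ρ` at comparable strings are
comparable, so their total measure is at most `2^{-(n+1)}` (`real_iUnion_cyl₂_le`). If `ρ` recovered
`y` while the infimum is zero, the random pair would lie in every level. -/

namespace AlgRand

open MeasureTheory Filter Topology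

/-! ### Recursively enumerable predicates -/

section RE
variable {α β : Type} [Primcodable α] [Primcodable β]

/-- An r.e. predicate is the union of an increasing primitive recursive family of stages. -/
theorem exists_stages {p : α → Prop} (hp : REPred p) :
    ∃ R : α → ℕ → Prop, PrimrecRel R ∧ (∀ a s t, s ≤ t → R a s → R a t) ∧
      ∀ a, p a ↔ ∃ t, R a t := by
  obtain ⟨c, hc⟩ := Nat.Partrec.Code.exists_code.1 hp
  refine ⟨fun a t => (Nat.Partrec.Code.evaln t c (Encodable.encode a)).isSome = true, ?_, ?_, ?_⟩
  · have h1 : Primrec fun q : α × ℕ => Nat.Partrec.Code.evaln q.2 c (Encodable.encode q.1) :=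
      Nat.Partrec.Code.primrec_evaln.comp
        ((Primrec.snd.pair (Primrec.const c)).pair (Primrec.encode.comp Primrec.fst))
    exact Primrec.eq.comp (Primrec.option_isSome.comp h1) (Primrec.const true)
  · intro a s t hst hs
    obtain ⟨x, hx⟩ := Option.isSome_iff_exists.1 hs
    exact Option.isSome_iff_exists.2 ⟨x, Nat.Partrec.Code.evaln_mono hst hx⟩
  · intro a
    have h2 : p a ↔ (Nat.Partrec.Code.eval c (Encodable.encode a)).Dom := by
      rw [hc]
      simp [Part.assert]
    rw [h2, Part.dom_iff_mem]
    constructor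
    · rintro ⟨x, hx⟩
      obtain ⟨k, hk⟩ := Nat.Partrec.Code.evaln_complete.1 hx
      exact ⟨k, Option.isSome_iff_exists.2 ⟨x, hk⟩⟩
    · rintro ⟨t, ht⟩
      obtain ⟨x, hx⟩ := Option.isSome_iff_exists.1 ht
      exact ⟨x, Nat.Partrec.Code.evaln_complete.2 ⟨t, hx⟩⟩

theorem rePred_exists_nat {R : α → ℕ → Bool} (hR : Computable₂ R) :
    REPred fun a => ∃ t, R a t = true := by
  have h : Partrec fun a => Nat.rfind (R a : ℕ →. Bool) := Partrec.rfind hR.partrec₂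
  refine h.dom_re.of_eq fun a => ?_
  rw [Nat.rfind_dom']
  simp

theorem rePred_of_stages {R : α → ℕ → Prop} (hR : PrimrecRel R) :
    REPred fun a => ∃ t, R a t := by
  classical
  exact (rePred_exists_nat (R := fun a t => decide (R a t)) (hR.decide).to_comp).of_eq
    fun a => by simp

theorem rePred_comp {p : β → Prop} (hp : REPred p) {f : α → β} (hf : Computable f) :
    REPred fun a => p (f a) :=
  Partrec.comp hp hf

theorem rePred_and {p q : α → Prop} (hp : REPred p) (hq : REPred q) :
    REPred fun a => p a ∧ q a := by
  obtain ⟨R, hR, mR, eR⟩ := exists_stages hp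
  obtain ⟨S, hS, mS, eS⟩ := exists_stages hq
  refine (rePred_of_stages (R := fun a t => R a t ∧ S a t)
    (PrimrecPred.and hR hS)).of_eq fun a => ?_
  rw [eR, eS]
  constructor
  · rintro ⟨t, h1, h2⟩
    exact ⟨⟨t, h1⟩, t, h2⟩
  · rintro ⟨⟨s, h1⟩, t, h2⟩
    exact ⟨max s t, mR _ _ _ (le_max_left _ _) h1, mS _ _ _ (le_max_right _ _) h2⟩

theorem rePred_or {p q : α → Prop} (hp : REPred p) (hq : REPred q) :
    REPred fun a => p a ∨ q a := by
  obtain ⟨R, hR, -, eR⟩ := exists_stages hp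
  obtain ⟨S, hS, -, eS⟩ := exists_stages hq
  refine (rePred_of_stages (R := fun a t => R a t ∨ S a t)
    (PrimrecPred.or hR hS)).of_eq fun a => ?_
  rw [eR, eS, exists_or]

/-- A partial computable choice function for an r.e. relation. -/
theorem exists_partrec_choice {p : α × β → Prop} (hp : REPred p) :
    ∃ ρ : α →. β, Partrec ρ ∧ (∀ a b, b ∈ ρ a → p (a, b)) ∧
      ∀ a, (∃ b, p (a, b)) → (ρ a).Dom := by
  classical
  obtain ⟨R, hR, mR, eR⟩ := exists_stages hp
  -- Dovetailing: `s` codes a candidate together with a stage at which to test it.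
  let g : α → ℕ → Option β := fun a s =>
    (Encodable.decode (α := β) s.unpair.1).bind fun b =>
      if R (a, b) s.unpair.2 then some b else none
  have hg : Primrec₂ g := by
    refine Primrec.option_bind
      (Primrec.decode.comp (Primrec.fst.comp (Primrec.unpair.comp Primrec.snd))) ?_
    refine Primrec.ite (hR.comp
      ((Primrec.fst.comp Primrec.fst).pair Primrec.snd)
      (Primrec.snd.comp (Primrec.unpair.comp (Primrec.snd.comp Primrec.fst))))
      (Primrec.option_some.comp Primrec.snd) (Primrec.const none)
  refine ⟨fun a => Nat.rfindOpt (g a), Partrec.rfindOpt hg.to_comp, ?_, ?_⟩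
  · intro a b hb
    obtain ⟨s, hs⟩ := Nat.rfindOpt_spec hb
    simp only [g, Option.mem_def, Option.bind_eq_some_iff] at hs
    obtain ⟨b', -, hb'⟩ := hs
    split_ifs at hb' with h
    cases hb'
    exact (eR _).2 ⟨_, h⟩
  · rintro a ⟨b, hb⟩
    obtain ⟨t, ht⟩ := (eR _).1 hb
    refine Nat.rfindOpt_dom.2 ⟨Nat.pair (Encodable.encode b) t, b, ?_⟩
    simp [g, ht]

theorem rePred_exists {p : α × β → Prop} (hp : REPred p) : REPred fun a => ∃ b, p (a, b) := by
  obtain ⟨ρ, hρ, h1, h2⟩ := exists_partrec_choice hp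
  exact hρ.dom_re.of_eq fun a => ⟨fun h => ⟨_, h1 a _ (Part.get_mem h)⟩, h2 a⟩

/-- Stages are monotone, so the finitely many instances all hold at the maximum of their stages. -/
theorem rePred_forall_lt {p : α × ℕ → Prop} (hp : REPred p) :
    REPred fun q : α × ℕ => ∀ m < q.2, p (q.1, m) := by
  obtain ⟨R, hR, mR, eR⟩ := exists_stages hp
  have h1 : PrimrecRel fun (m : ℕ) (y : α × ℕ) => R (y.1, m) y.2 :=
    hR.comp ((Primrec.fst.comp Primrec.snd).pair Primrec.fst) (Primrec.snd.comp Primrec.snd)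
  have h2 : PrimrecPred fun u : (α × ℕ) × ℕ => ∀ m < u.1.2, R (u.1.1, m) u.2 :=
    (h1.forall_mem_list.comp (f := fun u : (α × ℕ) × ℕ => List.range u.1.2)
      (g := fun u => (u.1.1, u.2)) (Primrec.list_range.comp (Primrec.snd.comp Primrec.fst))
      ((Primrec.fst.comp Primrec.fst).pair Primrec.snd)).of_eq fun u => by simp
  refine (rePred_of_stages (R := fun (q : α × ℕ) (t : ℕ) => ∀ m < q.2, R (q.1, m) t) h2).of_eq fun q => ?_
  constructor
  · rintro ⟨t, ht⟩ m hm
    exact (eR _).2 ⟨t, ht m hm⟩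
  · intro h
    have h3 : ∀ m, ∃ t, m < q.2 → R (q.1, m) t := fun m => by
      by_cases hm : m < q.2
      · obtain ⟨t, ht⟩ := (eR _).1 (h m hm)
        exact ⟨t, fun _ => ht⟩
      · exact ⟨0, fun h => absurd h hm⟩
    choose t ht using h3
    exact ⟨(Finset.range q.2).sup t, fun m hm =>
      mR _ _ _ (Finset.le_sup (Finset.mem_range.2 hm)) (ht m hm)⟩

theorem rePred_of_computable_eq [DecidableEq β] {f g : α → β} (hf : Computable f)
    (hg : Computable g) : REPred fun a => f a = g a := by
  have h : Computable fun a => decide (f a = g a) :=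
    Computable₂.comp Primrec.eq.decide.to_comp hf hg
  refine ComputablePred.to_re ⟨inferInstance, h⟩

theorem rePred_prefix [DecidableEq β] {f g : α → List β} (hf : Computable f)
    (hg : Computable g) : REPred fun a => f a <+: g a := by
  have h : Computable fun a => (g a).take (f a).length :=
    Primrec.list_take.to_comp.comp (Computable.list_length.comp hf) hg
  exact (rePred_of_computable_eq hf h).of_eq fun a => List.prefix_iff_eq_take.symm

/-- From a marked element in each of infinitely many fibres of bounded size of an r.e. relation,
infinitely many are found by a partial computable function. -/
theorem exists_partrec_infinite (K : ℕ) {p : α × β → Prop} (hp : REPred p) {I : Set α}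
    (hI : I.Infinite) (y : α → β) (hy : ∀ a ∈ I, p (a, y a))
    (hK : ∀ a ∈ I, ∀ s : Finset β, (∀ b ∈ s, p (a, b)) → s.card ≤ K) :
    ∃ ρ : α →. β, Partrec ρ ∧ {a ∈ I | y a ∈ ρ a}.Infinite := by
  classical
  induction K generalizing p I with
  | zero =>
    obtain ⟨a, ha⟩ := hI.nonempty
    have := hK a ha {y a} (by simpa using hy a ha)
    simp at this
  | succ K ih =>
    obtain ⟨ρ, hρ, h1, h2⟩ := exists_partrec_choice hp
    by_cases hinf : {a ∈ I | y a ∈ ρ a}.Infinite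
    · exact ⟨ρ, hρ, hinf⟩
    have hJ : {a ∈ I | y a ∉ ρ a}.Infinite := by
      intro hfin
      refine hI (((Set.not_infinite.1 hinf).union hfin).subset fun a ha => ?_)
      by_cases h : y a ∈ ρ a
      · exact Or.inl ⟨ha, h⟩
      · exact Or.inr ⟨ha, h⟩
    -- The chosen element is discarded by asking that the choice halt with a different value; mere
    -- non-membership in `ρ q.1` need not be r.e.
    have hgraph : REPred fun q : α × β => ∃ b ∈ ρ q.1, b ≠ q.2 := by
      have hne : REPred fun u : (α × β) × β => u.2 ≠ u.1.2 := by
        have h : ComputablePred fun u : (α × β) × β => u.2 ≠ u.1.2 := by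
          refine ⟨inferInstance, ?_⟩
          have h0 : Primrec fun u : (α × β) × β =>
              decide (¬ Encodable.encode u.2 = Encodable.encode u.1.2) :=
            (PrimrecPred.not (Primrec.eq.comp (Primrec.encode.comp Primrec.snd)
              (Primrec.encode.comp (Primrec.snd.comp Primrec.fst)))).decide
          refine h0.to_comp.of_eq fun u => ?_
          simp
        exact h.to_re
      have h3 : Partrec fun q : α × β => (ρ q.1).bind fun b =>
          Part.assert (b ≠ q.2) fun _ => Part.some () :=
        Partrec.bind (hρ.comp Computable.fst) hne
      refine h3.dom_re.of_eq fun q => ?_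
      simp [Part.dom_iff_mem, Part.mem_assert_iff]
    -- Where the choice is wrong, the fibre loses the chosen element but keeps `y a`, so the bound
    -- drops to `K`.
    obtain ⟨ρ', hρ', h'⟩ := ih (p := fun q => p q ∧ ∃ b ∈ ρ q.1, b ≠ q.2) (rePred_and hp hgraph)
      hJ
      (fun a ha => ⟨hy a ha.1, _, Part.get_mem (h2 a ⟨_, hy a ha.1⟩), fun h =>
        ha.2 (by rw [← show _ = y a from h]; exact Part.get_mem _)⟩)
      (fun a ha s hs => by
        have hdom := h2 a ⟨_, hy a ha.1⟩
        have hnot : (ρ a).get hdom ∉ s := fun hmem => by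
          obtain ⟨b, hb, hne⟩ := (hs _ hmem).2
          exact hne (Part.mem_unique hb (Part.get_mem hdom))
        have := hK a ha.1 (insert ((ρ a).get hdom) s) (fun b hb => by
          rcases Finset.mem_insert.1 hb with rfl | hb
          · exact h1 _ _ (Part.get_mem hdom)
          · exact (hs b hb).1)
        rw [Finset.card_insert_of_notMem hnot] at this
        omega)
    exact ⟨ρ', hρ', h'.mono fun a ha => ⟨ha.1.1, ha.2⟩⟩

end RE

/-! ### Strings and cylinders -/

@[simp] theorem length_initSeg (w : Seq) (n : ℕ) : (initSeg w n).length = n := by simp [initSeg]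

theorem isPrefixOf_initSeg (w : Seq) (n : ℕ) : IsPrefixOf (initSeg w n) w := by
  intro i hi
  simp [initSeg]

theorem IsPrefixOf.eq_initSeg {x : Word} {w : Seq} (hx : IsPrefixOf x w) :
    x = initSeg w x.length := by
  refine List.ext_getElem (by simp) fun i h1 h2 => ?_
  rw [hx i h1]
  exact (isPrefixOf_initSeg w _ i h2).symm

theorem initSeg_prefix (w : Seq) {m n : ℕ} (hmn : m ≤ n) : initSeg w m <+: initSeg w n := by
  rw [List.prefix_iff_eq_take]
  refine List.ext_getElem (by simpa using hmn) fun i h1 h2 => ?_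
  rw [List.getElem_take]
  rw [isPrefixOf_initSeg w _ i h1, isPrefixOf_initSeg w _ i]

theorem take_initSeg (w : Seq) {m n : ℕ} (hmn : m ≤ n) :
    (initSeg w n).take m = initSeg w m := by
  have := List.prefix_iff_eq_take.1 (initSeg_prefix w hmn)
  simpa using this.symm

theorem IsPrefixOf.of_prefix {x y : Word} {w : Seq} (hxy : x <+: y) (hy : IsPrefixOf y w) :
    IsPrefixOf x w := by
  intro i hi
  rw [hxy.getElem hi]
  exact hy i (lt_of_lt_of_le hi hxy.length_le)

theorem IsPrefixOf.prefix {x y : Word} {w : Seq} (hx : IsPrefixOf x w) (hy : IsPrefixOf y w)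
    (hl : x.length ≤ y.length) : x <+: y := by
  rw [hx.eq_initSeg, hy.eq_initSeg]
  exact initSeg_prefix w hl

theorem cyl_subset {x y : Word} (hxy : x <+: y) : cyl y ⊆ cyl x :=
  fun _ hw => IsPrefixOf.of_prefix hxy hw

@[simp] theorem cyl_nil : cyl [] = Set.univ := by
  ext w
  simp [cyl, IsPrefixOf]

theorem disjoint_cyl {x y : Word} (hl : x.length ≤ y.length) (hxy : ¬ x <+: y) :
    Disjoint (cyl x) (cyl y) :=
  Set.disjoint_left.2 fun _ hx hy => hxy (IsPrefixOf.prefix hx hy hl)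

theorem measurableSet_cyl (x : Word) : MeasurableSet (cyl x) := by
  have : cyl x = ⋂ i : Fin x.length, {w : Seq | x[i] = w i} := by
    ext w
    simp only [cyl, IsPrefixOf, Set.mem_ofPred_eq, Set.mem_iInter]
    exact ⟨fun h i => h i i.2, fun h i hi => h ⟨i, hi⟩⟩
  rw [this]
  exact MeasurableSet.iInter fun i => measurableSet_eq_fun measurable_const (measurable_pi_apply _)

theorem measurableSet_cyl₂ (x y : Word) : MeasurableSet (cyl₂ x y) :=
  (measurableSet_cyl x).prod (measurableSet_cyl y)

theorem cyl₂_subset {x x' y y' : Word} (hx : x <+: x') (hy : y <+: y') :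
    cyl₂ x' y' ⊆ cyl₂ x y :=
  Set.prod_mono (cyl_subset hx) (cyl_subset hy)

section Measure
variable (P : Measure (Seq × Seq))

theorem real_cyl₂_mono [IsProbabilityMeasure P] {x x' y y' : Word} (hx : x <+: x') (hy : y <+: y') :
    P.real (cyl₂ x' y') ≤ P.real (cyl₂ x y) :=
  measureReal_mono (cyl₂_subset hx hy)

theorem sum_real_cyl₂_le [IsProbabilityMeasure P] (x z : Word) (n : ℕ) (s : Finset Word)
    (hs : ∀ y ∈ s, y.length = n ∧ z <+: y) :
    ∑ y ∈ s, P.real (cyl₂ x y) ≤ P.real (cyl₂ x z) := by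
  rw [← measureReal_biUnion_finset]
  · exact measureReal_mono (Set.iUnion₂_subset fun y hy =>
      cyl₂_subset (List.prefix_refl x) (hs y hy).2)
  · intro y hy y' hy' hne
    refine Set.disjoint_prod.2 (Or.inr (disjoint_cyl ?_ fun h => hne ?_))
    · rw [(hs y hy).1, (hs y' hy').1]
    · exact h.eq_of_length (by rw [(hs y hy).1, (hs y' hy').1])
  · exact fun y _ => measurableSet_cyl₂ x y

/-! ### Conditional probabilities -/

theorem condProb_nonneg (y x : Word) : 0 ≤ condProb P y x := by
  unfold condProb
  split_ifs
  · positivity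
  · exact le_rfl

theorem condProb_mono [IsProbabilityMeasure P] {y y' : Word} (h : y <+: y') (x : Word) :
    condProb P y' x ≤ condProb P y x := by
  unfold condProb
  split_ifs with h0
  · exact div_le_div_of_nonneg_right (real_cyl₂_mono P (List.prefix_refl x) h) h0.le
  · exact le_rfl

theorem lt_condProb {x y : Word} {c : ℝ} (hc : 0 ≤ c) (h : c < condProb P y x) :
    0 < P.real (cyl₂ x []) ∧ c * P.real (cyl₂ x []) < P.real (cyl₂ x y) := by
  unfold condProb at h
  split_ifs at h with h0
  · exact ⟨h0, (lt_div_iff₀ h0).1 h⟩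
  · exact absurd h hc.not_gt

theorem condProb_lt {x y : Word} {c : ℝ} (h0 : 0 < P.real (cyl₂ x []))
    (h : condProb P y x < c) : P.real (cyl₂ x y) < c * P.real (cyl₂ x []) := by
  rw [condProb, if_pos h0] at h
  exact (div_lt_iff₀ h0).1 h

theorem mem_matchedAlong_iff {h : ℕ → ℕ} {w : Seq × Seq} {q : Word × Word} :
    q ∈ matchedAlong h w ↔ ∃ n, q = (initSeg w.1 (h n), initSeg w.2 n) := by
  constructor
  · rintro ⟨h1, h2, h3⟩
    refine ⟨q.2.length, Prod.ext ?_ h3.eq_initSeg⟩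
    exact h2.eq_initSeg.trans (by rw [show q.1.length = h q.2.length from h1])
  · rintro ⟨n, rfl⟩
    exact ⟨by simp [matched], isPrefixOf_initSeg _ _, isPrefixOf_initSeg _ _⟩

theorem infCondProb_le (h : ℕ → ℕ) (w : Seq × Seq) (n : ℕ) :
    infCondProb P h w ≤ condProb P (initSeg w.2 n) (initSeg w.1 (h n)) := by
  refine csInf_le ⟨0, ?_⟩ ⟨_, mem_matchedAlong_iff.2 ⟨n, rfl⟩, rfl⟩
  rintro _ ⟨q, -, rfl⟩
  exact condProb_nonneg P _ _

theorem exists_condProb_lt {h : ℕ → ℕ} {w : Seq × Seq} {ε : ℝ} (hε : infCondProb P h w < ε) :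
    ∃ n, condProb P (initSeg w.2 n) (initSeg w.1 (h n)) < ε := by
  obtain ⟨_, ⟨q, hq, rfl⟩, hlt⟩ := exists_lt_of_csInf_lt
    (⟨_, _, mem_matchedAlong_iff.2 ⟨0, rfl⟩, rfl⟩ :
      ((fun q : Word × Word => condProb P q.2 q.1) '' matchedAlong h w).Nonempty) hε
  obtain ⟨n, rfl⟩ := mem_matchedAlong_iff.1 hq
  exact ⟨n, hlt⟩

end Measure

/-! ### Comparing the probabilities of rectangles -/

/-- Nonnegative integers have even codes and negative ones odd codes, so a parity test and a halving
suffice. -/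
theorem computable_toNat : Computable Int.toNat := by
  have h : Computable fun z : ℤ =>
      bif (Encodable.encode z).bodd then 0 else (Encodable.encode z).div2 :=
    Computable.cond (Computable.nat_bodd.comp Computable.encode) (Computable.const 0)
      (Computable.nat_div2.comp Computable.encode)
  refine h.of_eq fun z => ?_
  cases z with
  | ofNat n =>
    rw [show Encodable.encode (Int.ofNat n) = 2 * n from rfl]
    simp
  | negSucc n =>
    rw [show Encodable.encode (Int.negSucc n) = 2 * n + 1 from rfl]
    simp

/-- The inequality holds iff at some precision the upper estimate of `i * p₁` is below the lower
estimate of `j * p₂`. Denominators are cleared to leave a decidable comparison of naturals. -/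
theorem exists_stage_lt {i j : ℕ} {p₁ p₂ : ℝ} (hp₁ : 0 ≤ p₁) (hp₂ : 0 ≤ p₂) {a₁ a₂ : ℕ → ℤ}
    {b₁ b₂ : ℕ → ℕ} (hb₁ : ∀ k, 0 < b₁ k) (hb₂ : ∀ k, 0 < b₂ k)
    (h₁ : ∀ k, 0 < k → |p₁ - (a₁ k : ℝ) / (b₁ k : ℝ)| < 1 / (k : ℝ))
    (h₂ : ∀ k, 0 < k → |p₂ - (a₂ k : ℝ) / (b₂ k : ℝ)| < 1 / (k : ℝ)) :
    (∃ k, i * ((a₁ (k + 1)).toNat * (k + 1) + b₁ (k + 1)) * b₂ (k + 1)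
      + j * b₁ (k + 1) * b₂ (k + 1) < j * (a₂ (k + 1)).toNat * (k + 1) * b₁ (k + 1)) ↔
      i * p₁ < j * p₂ := by
  -- As `p` is nonnegative, replacing a negative approximation by zero does not increase the error.
  have key : ∀ {p : ℝ} {a : ℤ} {b k : ℕ}, 0 ≤ p → 0 < b → 0 < k →
      |p - (a : ℝ) / (b : ℝ)| < 1 / (k : ℝ) → |p - (a.toNat : ℝ) / (b : ℝ)| < 1 / (k : ℝ) := by
    intro p a b k hp hb hk h
    have hb' : (0 : ℝ) < b := by exact_mod_cast hb
    rcases le_total 0 a with ha | ha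
    · have : ((a.toNat : ℕ) : ℝ) = (a : ℝ) := by
        rw [← Int.cast_natCast, Int.toNat_of_nonneg ha]
      rwa [this]
    · rw [Int.toNat_of_nonpos ha]
      have : (a : ℝ) / b ≤ 0 := div_nonpos_of_nonpos_of_nonneg (by exact_mod_cast ha) hb'.le
      rw [abs_lt] at h ⊢
      simp only [Nat.cast_zero, zero_div, sub_zero]
      constructor <;> linarith
  have stage : ∀ k : ℕ, (i * ((a₁ (k + 1)).toNat * (k + 1) + b₁ (k + 1)) * b₂ (k + 1)
      + j * b₁ (k + 1) * b₂ (k + 1) < j * (a₂ (k + 1)).toNat * (k + 1) * b₁ (k + 1)) ↔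
      (i : ℝ) * (((a₁ (k + 1)).toNat : ℝ) / b₁ (k + 1) + 1 / ((k + 1 : ℕ) : ℝ)) <
        j * (((a₂ (k + 1)).toNat : ℝ) / b₂ (k + 1) - 1 / ((k + 1 : ℕ) : ℝ)) := by
    intro k
    have e1 : (0 : ℝ) < b₁ (k + 1) := by exact_mod_cast hb₁ _
    have e2 : (0 : ℝ) < b₂ (k + 1) := by exact_mod_cast hb₂ _
    have e3 : (0 : ℝ) < ((k + 1 : ℕ) : ℝ) := by positivity
    have e4 : (0 : ℝ) < b₁ (k + 1) * b₂ (k + 1) * ((k + 1 : ℕ) : ℝ) := by positivity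
    rw [← mul_lt_mul_iff_left₀ e4, ← Nat.cast_lt (α := ℝ)]
    have l : (i : ℝ) * (((a₁ (k + 1)).toNat : ℝ) / b₁ (k + 1) + 1 / ((k + 1 : ℕ) : ℝ)) *
        (b₁ (k + 1) * b₂ (k + 1) * ((k + 1 : ℕ) : ℝ)) =
        i * ((a₁ (k + 1)).toNat * ((k + 1 : ℕ) : ℝ) + b₁ (k + 1)) * b₂ (k + 1) := by
      field_simp
    have r : (j : ℝ) * (((a₂ (k + 1)).toNat : ℝ) / b₂ (k + 1) - 1 / ((k + 1 : ℕ) : ℝ)) *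
        (b₁ (k + 1) * b₂ (k + 1) * ((k + 1 : ℕ) : ℝ)) =
        j * (a₂ (k + 1)).toNat * ((k + 1 : ℕ) : ℝ) * b₁ (k + 1) -
          j * b₁ (k + 1) * b₂ (k + 1) := by
      field_simp
    rw [l, r, lt_sub_iff_add_lt]
    push_cast
    rfl
  simp only [stage]
  have ei : (0 : ℝ) ≤ i := Nat.cast_nonneg i
  have ej : (0 : ℝ) ≤ j := Nat.cast_nonneg j
  constructor
  · rintro ⟨k, hk⟩
    have g1 := abs_lt.1 (key hp₁ (hb₁ _) k.succ_pos (h₁ (k + 1) k.succ_pos))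
    have g2 := abs_lt.1 (key hp₂ (hb₂ _) k.succ_pos (h₂ (k + 1) k.succ_pos))
    refine (mul_le_mul_of_nonneg_left ?_ ei).trans_lt
      (hk.trans_le (mul_le_mul_of_nonneg_left ?_ ej))
    · linarith [g1.2]
    · linarith [g2.1]
  · intro h
    -- Each estimate is off by at most `2 / (k + 1)`: the approximation error plus the safety
    -- margin.
    obtain ⟨k, hk⟩ := exists_nat_gt (2 * ((i : ℝ) + j) / (j * p₂ - i * p₁))
    refine ⟨k, ?_⟩
    have g1 := abs_lt.1 (key hp₁ (hb₁ _) k.succ_pos (h₁ (k + 1) k.succ_pos))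
    have g2 := abs_lt.1 (key hp₂ (hb₂ _) k.succ_pos (h₂ (k + 1) k.succ_pos))
    have e3 : (0 : ℝ) < ((k + 1 : ℕ) : ℝ) := by positivity
    have hd : 2 * ((i : ℝ) + j) * (1 / ((k + 1 : ℕ) : ℝ)) < j * p₂ - i * p₁ := by
      rw [mul_one_div, div_lt_iff₀ e3]
      rw [div_lt_iff₀ (by linarith)] at hk
      push_cast
      nlinarith
    have m1 : (i : ℝ) * (((a₁ (k + 1)).toNat : ℝ) / b₁ (k + 1) + 1 / ((k + 1 : ℕ) : ℝ)) ≤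
        i * (p₁ + 2 * (1 / ((k + 1 : ℕ) : ℝ))) :=
      mul_le_mul_of_nonneg_left (by linarith [g1.1]) ei
    have m2 : j * (p₂ - 2 * (1 / ((k + 1 : ℕ) : ℝ))) ≤
        (j : ℝ) * (((a₂ (k + 1)).toNat : ℝ) / b₂ (k + 1) - 1 / ((k + 1 : ℕ) : ℝ)) :=
      mul_le_mul_of_nonneg_left (by linarith [g2.2]) ej
    linarith

theorem rePred_measure_lt {α : Type} [Primcodable α] {P : Measure (Seq × Seq)}
    (hP : IsComputableMeasure P) {i j : α → ℕ} {u v : α → Word × Word} (hi : Computable i)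
    (hj : Computable j) (hu : Computable u) (hv : Computable v) :
    REPred fun q => (i q : ℝ) * P.real (cyl₂ (u q).1 (u q).2) <
      (j q : ℝ) * P.real (cyl₂ (v q).1 (v q).2) := by
  obtain ⟨a, b, ha, hb, hb0, happ⟩ := hP
  have hK : Computable fun r : α × ℕ => r.2 + 1 := Computable.succ.comp Computable.snd
  have hu' : Computable fun r : α × ℕ => (u r.1, r.2 + 1) := (hu.comp Computable.fst).pair hK
  have hv' : Computable fun r : α × ℕ => (v r.1, r.2 + 1) := (hv.comp Computable.fst).pair hK
  have hi' : Computable fun r : α × ℕ => i r.1 := hi.comp Computable.fst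
  have hj' : Computable fun r : α × ℕ => j r.1 := hj.comp Computable.fst
  have a1 : Computable fun r : α × ℕ => (a (u r.1, r.2 + 1)).toNat :=
    computable_toNat.comp (ha.comp hu')
  have a2 : Computable fun r : α × ℕ => (a (v r.1, r.2 + 1)).toNat :=
    computable_toNat.comp (ha.comp hv')
  have b1 : Computable fun r : α × ℕ => b (u r.1, r.2 + 1) := hb.comp hu'
  have b2 : Computable fun r : α × ℕ => b (v r.1, r.2 + 1) := hb.comp hv'
  have mul : ∀ {f g : α × ℕ → ℕ}, Computable f → Computable g → Computable fun r => f r * g r :=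
    fun hf hg => Primrec.nat_mul.to_comp.comp hf hg
  have add : ∀ {f g : α × ℕ → ℕ}, Computable f → Computable g → Computable fun r => f r + g r :=
    fun hf hg => Primrec.nat_add.to_comp.comp hf hg
  have hlt : Computable₂ fun (q : α) (k : ℕ) => decide
      (i q * ((a (u q, k + 1)).toNat * (k + 1) + b (u q, k + 1)) * b (v q, k + 1)
        + j q * b (u q, k + 1) * b (v q, k + 1) <
        j q * (a (v q, k + 1)).toNat * (k + 1) * b (u q, k + 1)) :=
    Computable₂.comp Primrec.nat_lt.decide.to_comp
      (add (mul (mul hi' (add (mul a1 hK) b1)) b2) (mul (mul hj' b1) b2))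
      (mul (mul (mul hj' a2) hK) b1)
  refine (rePred_exists_nat hlt).of_eq fun q => ?_
  simp only [decide_eq_true_eq]
  exact exists_stage_lt measureReal_nonneg measureReal_nonneg (fun k => hb0 _) (fun k => hb0 _)
    (fun k hk => happ (u q).1 (u q).2 k hk) (fun k hk => happ (v q).1 (v q).2 k hk)

/-! ### Recovering the second sequence infinitely often -/

theorem exists_partrec_matchedAlong {P : Measure (Seq × Seq)} [IsProbabilityMeasure P]
    (hP : IsComputableMeasure P) {h : ℕ → ℕ} (hcomp : Computable h)
    (hunb : ∀ m, ∃ n, m ≤ h n) (w : Seq × Seq) (hinf : 0 < infCondProb P h w) :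
    ∃ ρ : Word →. Word, Partrec ρ ∧ {q ∈ matchedAlong h w | q.2 ∈ ρ q.1}.Infinite := by
  obtain ⟨c, hc0, hc⟩ := exists_rat_btwn hinf
  have hc0' : 0 < c := by exact_mod_cast hc0
  obtain ⟨i, j, hi, hj, rfl⟩ : ∃ i j : ℕ, 0 < i ∧ 0 < j ∧ c = (i : ℚ) / j :=
    ⟨c.num.toNat, c.den, by have := Rat.num_pos.2 hc0'; omega, c.den_pos, by
      have h1 : ((c.num.toNat : ℕ) : ℚ) = (c.num : ℚ) := by
        rw [← Int.cast_natCast, Int.toNat_of_nonneg (Rat.num_pos.2 hc0').le]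
      rw [h1, Rat.num_div_den]⟩
  have hjR : (0 : ℝ) < j := by exact_mod_cast hj
  have hiR : (1 : ℝ) ≤ i := by exact_mod_cast hi
  -- Several lengths of `y` may match one length of `x`; keeping only the least makes the fibres
  -- antichains of bounded size.
  let N : ℕ → ℕ := fun l => sInf {n | h n = l}
  have hN : ∀ l ∈ Set.range h, h (N l) = l := fun l hl => Nat.sInf_mem (s := {n | h n = l}) hl
  have hNmin : ∀ l, ∀ m < N l, h m ≠ l := fun l m hm => Nat.notMem_of_lt_sInf (s := {n | h n = l}) hm
  let p : Word × Word → Prop := fun q =>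
    (h q.2.length = q.1.length ∧ ∀ m < q.2.length, ¬ h m = q.1.length) ∧
      (i : ℝ) * P.real (cyl₂ q.1 []) < (j : ℝ) * P.real (cyl₂ q.1 q.2)
  have hp : REPred p := by
    refine rePred_and (rePred_and ?_ ?_) ?_
    · exact rePred_of_computable_eq
        (hcomp.comp (Computable.list_length.comp Computable.snd))
        (Computable.list_length.comp Computable.fst)
    · have h1 : REPred fun u : (Word × Word) × ℕ => ¬ h u.2 = u.1.1.length := by
        refine ComputablePred.to_re ⟨inferInstance, ?_⟩
        have h2 : Primrec₂ fun s t : ℕ => decide (¬ s = t) := (PrimrecPred.not Primrec.eq).decide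
        exact Computable₂.comp h2.to_comp (hcomp.comp Computable.snd)
          (Computable.list_length.comp (Computable.fst.comp Computable.fst))
      exact rePred_comp (rePred_forall_lt h1) (f := fun q : Word × Word => (q, q.2.length))
        (Computable.id.pair (Computable.list_length.comp Computable.snd))
    · exact rePred_measure_lt hP (i := fun _ => i) (j := fun _ => j)
        (u := fun q : Word × Word => (q.1, [])) (v := fun q => (q.1, q.2)) (Computable.const i)
        (Computable.const j) (Computable.fst.pair (Computable.const []))
        (Computable.fst.pair Computable.snd)
  let I : Set Word := initSeg w.1 '' Set.range h
  have hI : I.Infinite := by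
    refine Set.Infinite.image (fun a _ b _ hab => ?_) ?_
    · simpa using congrArg List.length hab
    · refine Set.infinite_of_not_bddAbove fun ⟨B, hB⟩ => ?_
      obtain ⟨n, hn⟩ := hunb (B + 1)
      have := hB ⟨n, rfl⟩
      omega
  have hy : ∀ a ∈ I, p (a, initSeg w.2 (N a.length)) := by
    rintro _ ⟨l, hl, rfl⟩
    refine ⟨⟨by simp [hN l hl], by simpa using hNmin l⟩, ?_⟩
    have h1 := hc.trans_le (infCondProb_le P h w (N l))
    rw [hN l hl] at h1
    have h2 := (lt_condProb P hc0.le h1).2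
    push_cast at h2
    rw [div_mul_eq_mul_div, div_lt_iff₀ hjR] at h2
    simp only [length_initSeg]
    linarith
  -- The cylinders are disjoint and each carries more than `i / j ≥ 1 / j` of the mass of `a`.
  have hK : ∀ a ∈ I, ∀ s : Finset Word, (∀ b ∈ s, p (a, b)) → s.card ≤ j := by
    intro a ha s hs
    have hlen : ∀ b ∈ s, b.length = N a.length := by
      intro b hb
      have h1 := hs b hb
      have h2 := hN a.length ⟨_, h1.1.1⟩
      rcases lt_trichotomy b.length (N a.length) with h3 | h3 | h3
      · exact absurd h1.1.1 (hNmin _ _ h3)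
      · exact h3
      · exact absurd h2 (h1.1.2 _ h3)
    have hsum := sum_real_cyl₂_le P a [] (N a.length) s fun b hb => ⟨hlen b hb, List.nil_prefix⟩
    rcases s.eq_empty_or_nonempty with rfl | ⟨b, hb⟩
    · simp
    have hpos : 0 < P.real (cyl₂ a []) := by
      have h1 := (hs b hb).2
      have h2 := real_cyl₂_mono P (List.prefix_refl a) (List.nil_prefix (l := b))
      by_contra h3
      have h4 : P.real (cyl₂ a []) = 0 := le_antisymm (not_lt.1 h3) measureReal_nonneg
      have h5 : P.real (cyl₂ a b) = 0 := le_antisymm (h4 ▸ h2) measureReal_nonneg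
      rw [h4, h5] at h1
      simp at h1
    have h6 : (s.card : ℝ) * (i * P.real (cyl₂ a [])) ≤ j * ∑ y ∈ s, P.real (cyl₂ a y) := by
      rw [Finset.mul_sum, ← nsmul_eq_mul]
      exact Finset.card_nsmul_le_sum _ _ _ fun y hy => (hs y hy).2.le
    have h7 : (s.card : ℝ) * P.real (cyl₂ a []) ≤ j * P.real (cyl₂ a []) :=
      calc (s.card : ℝ) * P.real (cyl₂ a [])
          ≤ s.card * (i * P.real (cyl₂ a [])) := by
            gcongr
            exact le_mul_of_one_le_left hpos.le hiR
        _ ≤ _ := h6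
        _ ≤ _ := by gcongr
    exact_mod_cast le_of_mul_le_mul_right h7 hpos
  obtain ⟨ρ, hρ, hρinf⟩ := exists_partrec_infinite j hp hI
    (fun a => initSeg w.2 (N a.length)) hy hK
  refine ⟨ρ, hρ, Set.infinite_of_injOn_mapsTo
    (f := fun a => (a, initSeg w.2 (N a.length))) (fun a _ b _ hab => (Prod.ext_iff.1 hab).1)
    ?_ hρinf⟩
  rintro _ ⟨⟨l, hl, rfl⟩, ha⟩
  refine ⟨mem_matchedAlong_iff.2 ⟨N l, ?_⟩, ha⟩
  simp [hN l hl]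

/-! ### Suprema of chains of strings -/

theorem Str.prefix_or_prefix {x y : Word} {s : Str} (hx : Str.fin x ≤ s) (hy : Str.fin y ≤ s) :
    x <+: y ∨ y <+: x := by
  cases s with
  | fin z => exact List.prefix_or_prefix_of_prefix hx hy
  | inf w =>
    rcases le_total x.length y.length with hl | hl
    · exact Or.inl (IsPrefixOf.prefix hx hy hl)
    · exact Or.inr (IsPrefixOf.prefix hy hx hl)

/-- Finite strings are compact: otherwise every member of `T` is a proper prefix of `y`, and
`y.dropLast` is an upper bound too short to extend `y`. -/
theorem Str.exists_prefix_of_le_isLUB {T : Set Word} (h0 : [] ∈ T) {s : Str}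
    (hs : IsLUB (Str.fin '' T) s) {y : Word} (hy : Str.fin y ≤ s) : ∃ z ∈ T, y <+: z := by
  by_contra! hcon
  have hlt : ∀ z ∈ T, z <+: y ∧ z.length < y.length := by
    intro z hz
    rcases Str.prefix_or_prefix (hs.1 ⟨z, hz, rfl⟩) hy with h | h
    · refine ⟨h, lt_of_le_of_ne h.length_le fun hl => hcon z hz ?_⟩
      rw [h.eq_of_length hl]
    · exact absurd h (hcon z hz)
  have hub : Str.fin y.dropLast ∈ upperBounds (Str.fin '' T) := by
    rintro _ ⟨z, hz, rfl⟩
    refine List.prefix_of_prefix_length_le (hlt z hz).1 (List.dropLast_prefix y) ?_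
    have := (hlt z hz).2
    rw [List.length_dropLast]
    omega
  have h1 : y <+: y.dropLast := hy.trans (hs.2 hub)
  have h2 := h1.length_le
  have h3 := (hlt [] h0).2
  rw [List.length_dropLast] at h2
  simp only [List.length_nil] at h3
  omega

/-- If lengths are unbounded, bit `i` of the supremum is read off any member longer than `i`;
otherwise a longest member is the supremum. -/
theorem Str.exists_isLUB_of_chain {T : Set Word} (h0 : [] ∈ T)
    (hT : ∀ x ∈ T, ∀ y ∈ T, x <+: y ∨ y <+: x) : ∃ s, IsLUB (Str.fin '' T) s := by
  have hget : ∀ x ∈ T, ∀ y ∈ T, ∀ i (hx : i < x.length) (hy : i < y.length), x[i] = y[i] := by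
    intro x hx y hy i hi hi'
    rcases hT x hx y hy with h | h
    · exact h.getElem hi
    · exact (h.getElem hi').symm
  by_cases hb : ∀ n, ∃ z ∈ T, n < z.length
  · choose z hzT hz using hb
    have hpre : ∀ x ∈ T, IsPrefixOf x fun i => (z i)[i]'(hz i) :=
      fun x hx i hi => hget x hx _ (hzT i) i hi (hz i)
    refine ⟨Str.inf fun i => (z i)[i]'(hz i), ?_, ?_⟩
    · rintro _ ⟨x, hx, rfl⟩
      exact hpre x hx
    · intro s hs
      cases s with
      | fin y =>
        have h1 : z y.length <+: y := hs ⟨_, hzT y.length, rfl⟩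
        exact absurd h1.length_le (hz y.length).not_ge
      | inf v =>
        refine (funext fun i => ?_ : (fun i => (z i)[i]'(hz i)) = v)
        exact (hs ⟨_, hzT i, rfl⟩ : IsPrefixOf (z i) v) i (hz i)
  · push Not at hb
    obtain ⟨n, hn⟩ := hb
    have hfin : (List.length '' T).Finite :=
      (Set.finite_Iic n).subset (by rintro _ ⟨z, hz, rfl⟩; exact hn z hz)
    obtain ⟨_, ⟨z, hz, rfl⟩, hmax⟩ := hfin.exists_maximal ⟨_, [], h0, rfl⟩
    refine ⟨Str.fin z, IsGreatest.isLUB ⟨⟨z, hz, rfl⟩, ?_⟩⟩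
    rintro _ ⟨x, hx, rfl⟩
    rcases hT x hx z hz with h | h
    · exact h
    · have := hmax ⟨x, hx, rfl⟩ h.length_le
      rw [h.eq_of_length_le this]

/-! ### Monotone functions from consistent r.e. relations -/

theorem exists_isComputableMonotone {F : Set (Word × Word)} (hF : REPred fun q => q ∈ F)
    (h0 : ∀ p, (p, []) ∈ F)
    (hcons : ∀ p z p' z', (p, z) ∈ F → (p', z') ∈ F → (p <+: p' ∨ p' <+: p) →
      (z <+: z' ∨ z' <+: z)) :
    ∃ ρ : Str → Str, IsComputableMonotone ρ ∧ ∀ p z, (p, z) ∈ F → Str.fin z ≤ ρ (Str.fin p) := by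
  have hset : ∀ A : Set Word, {t : Str | ∃ p' x : Word, p' ∈ A ∧ (p', x) ∈ F ∧ t = .fin x} =
      Str.fin '' {x | ∃ p' ∈ A, (p', x) ∈ F} := by
    intro A
    ext t
    constructor
    · rintro ⟨p', x, h1, h2, rfl⟩
      exact ⟨x, ⟨p', h1, h2⟩, rfl⟩
    · rintro ⟨x, ⟨p', h1, h2⟩, rfl⟩
      exact ⟨p', x, h1, h2, rfl⟩
  have hlub : ∀ p : Str, ∃ s, IsLUB
      {t : Str | ∃ p' x : Word, Str.fin p' ≤ p ∧ (p', x) ∈ F ∧ t = .fin x} s := by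
    intro p
    have h1 := hset {p' | Str.fin p' ≤ p}
    simp only [Set.mem_ofPred_eq] at h1
    rw [h1]
    refine Str.exists_isLUB_of_chain ⟨[], ?_, h0 []⟩ ?_
    · cases p with
      | fin y => exact List.nil_prefix
      | inf w => exact fun i hi => absurd hi (Nat.not_lt_zero i)
    · rintro x ⟨p₁, hp₁, hx⟩ y ⟨p₂, hp₂, hy⟩
      exact hcons _ _ _ _ hx hy (Str.prefix_or_prefix hp₁ hp₂)
  choose ρ hρ using hlub
  exact ⟨ρ, ⟨F, hF, fun p => ⟨h0 p, _, hρ (Str.fin p)⟩, hρ⟩,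
    fun p z hz => (hρ (Str.fin p)).1 ⟨p, z, le_rfl, hz, rfl⟩⟩

theorem exists_isComputableMonotone_of_unique {h : ℕ → ℕ} (hmono : Monotone h)
    (hcomp : Computable h) {C : Word × Word → Prop} (hC : REPred C)
    (huniq : ∀ x y y', C (x, y) → C (x, y') → y.length = y'.length → y = y') :
    ∃ ρ : Str → Str, IsComputableMonotone ρ ∧ ∀ p z : Word, p.length = h z.length →
      (∀ m ≤ z.length, C (p.take (h m), z.take m)) → Str.fin z ≤ ρ (Str.fin p) := by
  -- Demanding `C` at every level `m` makes `F` consistent: for a longer `z'` over an extension of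
  -- `p`, level `z.length` compares its truncation with `z` over the same `p`.
  let F : Set (Word × Word) := {q | q.2 = [] ∨ q.1.length = h q.2.length ∧
    ∀ m < q.2.length + 1, C (q.1.take (h m), q.2.take m)}
  have hF : REPred fun q => q ∈ F := by
    refine rePred_or ?_ (rePred_and ?_ ?_)
    · exact rePred_of_computable_eq Computable.snd (Computable.const [])
    · exact rePred_of_computable_eq (Computable.list_length.comp Computable.fst)
        (hcomp.comp (Computable.list_length.comp Computable.snd))
    · have h1 : REPred fun u : (Word × Word) × ℕ => C (u.1.1.take (h u.2), u.1.2.take u.2) :=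
        rePred_comp hC (f := fun u : (Word × Word) × ℕ => (u.1.1.take (h u.2), u.1.2.take u.2))
          ((Computable₂.comp Primrec.list_take.to_comp (hcomp.comp Computable.snd)
            (Computable.fst.comp Computable.fst)).pair
          (Computable₂.comp Primrec.list_take.to_comp Computable.snd
            (Computable.snd.comp Computable.fst)))
      exact rePred_comp (rePred_forall_lt h1) (f := fun q : Word × Word => (q, q.2.length + 1))
        (Computable.id.pair
          (Computable.succ.comp (Computable.list_length.comp Computable.snd)))
  have hle : ∀ p z p' z', (p, z) ∈ F → (p', z') ∈ F → (p <+: p' ∨ p' <+: p) →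
      z.length ≤ z'.length → z <+: z' := by
    intro p z p' z' hz hz' hpp hl
    rcases hz with hz | ⟨hz1, hz2⟩
    · rw [show z = [] from hz]
      exact List.nil_prefix
    rcases hz' with hz' | ⟨hz1', hz2'⟩
    · have h1 : z' = [] := hz'
      rw [h1, List.length_nil, Nat.le_zero, List.length_eq_zero_iff] at hl
      rw [hl]
      exact List.nil_prefix
    simp only at hz1 hz2 hz1' hz2'
    have hpl : p.length ≤ p'.length := by
      rw [hz1, hz1']
      exact hmono hl
    have hpre : p <+: p' := by
      rcases hpp with hp | hp
      · exact hp
      · rw [hp.eq_of_length_le hpl]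
    have h1 := hz2 z.length (Nat.lt_succ_self _)
    have h2 := hz2' z.length (Nat.lt_succ_of_le hl)
    rw [← hz1, List.take_length, List.take_length] at h1
    rw [← hz1, ← List.prefix_iff_eq_take.1 hpre] at h2
    rw [List.prefix_iff_eq_take]
    exact huniq _ _ _ h1 h2 (by simpa using hl)
  obtain ⟨ρ, hρ, hle'⟩ := exists_isComputableMonotone hF (fun p => Or.inl rfl)
    fun p z p' z' hz hz' hpp => by
      rcases le_total z.length z'.length with hl | hl
      · exact Or.inl (hle p z p' z' hz hz' hpp hl)
      · exact Or.inr (hle p' z' p z hz' hz hpp.symm hl)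
  exact ⟨ρ, hρ, fun p z hpz hall => hle' p z (Or.inr ⟨hpz, fun m hm =>
    hall m (Nat.lt_succ_iff.1 hm)⟩)⟩

/-! ### Recovering the second sequence monotonically -/

/-- If `y` eventually carries more than half of the conditional probability of one of its prefixes,
in an effectively recognisable way, then a computable monotone function finds it. -/
theorem exists_isComputableMonotone_of_majority {P : Measure (Seq × Seq)}
    [IsProbabilityMeasure P] (hP : IsComputableMeasure P) {h : ℕ → ℕ} (hmono : Monotone h)
    (hcomp : Computable h) (w : Seq × Seq) (N : ℕ) {c : ℚ} (hc : 0 < c)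
    (hlow : ∀ n, N ≤ n → (c : ℝ) < condProb P (initSeg w.2 n) (initSeg w.1 (h n)))
    (hup : ∀ n, N ≤ n → condProb P (initSeg w.2 N) (initSeg w.1 (h n)) < 2 * (c : ℝ)) :
    ∃ ρ : Str → Str, IsComputableMonotone ρ ∧
      ∀ q ∈ matchedAlong h w, Str.fin q.2 ≤ ρ (Str.fin q.1) := by
  obtain ⟨i, j, hj, rfl⟩ : ∃ i j : ℕ, 0 < j ∧ c = (i : ℚ) / j :=
    ⟨c.num.toNat, c.den, c.den_pos, by
      have h1 : ((c.num.toNat : ℕ) : ℚ) = (c.num : ℚ) := by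
        rw [← Int.cast_natCast, Int.toNat_of_nonneg (Rat.num_pos.2 hc).le]
      rw [h1, Rat.num_div_den]⟩
  have hjR : (0 : ℝ) < j := by exact_mod_cast hj
  have hcR : (0 : ℝ) ≤ (((i : ℚ) / j : ℚ) : ℝ) := by exact_mod_cast hc.le
  let yN := initSeg w.2 N
  -- Prefixes of `yN` are built in. Beyond them the tests are `P(y | x) > i / j` and `P(yN | x) < 2
  -- * i / j`, multiplied out.
  let C : Word × Word → Prop := fun q => q.2 <+: yN ∨ yN <+: q.2 ∧
    (i : ℝ) * P.real (cyl₂ q.1 []) < (j : ℝ) * P.real (cyl₂ q.1 q.2) ∧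
    (j : ℝ) * P.real (cyl₂ q.1 yN) < ((2 * i : ℕ) : ℝ) * P.real (cyl₂ q.1 [])
  have hC : REPred C := by
    refine rePred_or ?_ (rePred_and ?_ (rePred_and ?_ ?_))
    · exact rePred_prefix Computable.snd (Computable.const yN)
    · exact rePred_prefix (Computable.const yN) Computable.snd
    · exact rePred_measure_lt hP (i := fun _ => i) (j := fun _ => j)
        (u := fun q : Word × Word => (q.1, [])) (v := fun q => (q.1, q.2)) (Computable.const i)
        (Computable.const j) (Computable.fst.pair (Computable.const []))
        (Computable.fst.pair Computable.snd)
    · exact rePred_measure_lt hP (i := fun _ => j) (j := fun _ => 2 * i)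
        (u := fun q : Word × Word => (q.1, yN)) (v := fun q => (q.1, [])) (Computable.const j)
        (Computable.const _) (Computable.fst.pair (Computable.const yN))
        (Computable.fst.pair (Computable.const []))
  have huniq : ∀ x y y', C (x, y) → C (x, y') → y.length = y'.length → y = y' := by
    rintro x y y' (h1 | ⟨h1, h2, h3⟩) (h1' | ⟨h1', h2', h3'⟩) hl
    · exact (List.prefix_iff_eq_take.1 h1).trans (hl ▸ (List.prefix_iff_eq_take.1 h1').symm)
    · exact (h1.trans h1').eq_of_length hl
    · exact ((h1'.trans h1).eq_of_length hl.symm).symm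
    · by_contra hne
      have hsum := sum_real_cyl₂_le P x yN y.length {y, y'} (by simp_all)
      rw [Finset.sum_pair hne] at hsum
      have := mul_le_mul_of_nonneg_left hsum hjR.le
      simp only at h2 h2' h3
      push_cast at h3
      linarith
  obtain ⟨ρ, hρ, hρle⟩ := exists_isComputableMonotone_of_unique hmono hcomp hC huniq
  refine ⟨ρ, hρ, fun q hq => ?_⟩
  obtain ⟨n, rfl⟩ := mem_matchedAlong_iff.1 hq
  refine hρle _ _ (by simp) fun m hm => ?_
  rw [length_initSeg] at hm
  simp only [take_initSeg _ (hmono hm), take_initSeg _ hm]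
  rcases le_total m N with hmN | hmN
  · exact Or.inl (initSeg_prefix _ hmN)
  · have h1 := lt_condProb P hcR (hlow m hmN)
    refine Or.inr ⟨initSeg_prefix _ hmN, ?_, ?_⟩
    · have h2 := h1.2
      push_cast at h2
      rw [div_mul_eq_mul_div, div_lt_iff₀ hjR] at h2
      linarith
    · have h2 := condProb_lt P h1.1 (hup m hmN)
      push_cast at h2 ⊢
      rw [← mul_div_assoc, div_mul_eq_mul_div, lt_div_iff₀ hjR] at h2
      linarith

/-- Here `h` is eventually constant, so `x` is eventually fixed and the conditional probabilities
decrease to their infimum. -/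
theorem exists_majority_of_bounded {P : Measure (Seq × Seq)} [IsProbabilityMeasure P] {h : ℕ → ℕ}
    (hmono : Monotone h) {m : ℕ} (hb : ∀ n, h n < m) (w : Seq × Seq)
    (hinf : 0 < infCondProb P h w) :
    ∃ (N : ℕ) (c : ℚ), 0 < c ∧
      (∀ n, N ≤ n → (c : ℝ) < condProb P (initSeg w.2 n) (initSeg w.1 (h n))) ∧
      ∀ n, N ≤ n → condProb P (initSeg w.2 N) (initSeg w.1 (h n)) < 2 * (c : ℝ) := by
  obtain ⟨n₀, hn₀⟩ : ∃ n₀, ∀ n, n₀ ≤ n → h n = h n₀ := by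
    have hbdd : BddAbove (Set.range h) := ⟨m, by rintro _ ⟨n, rfl⟩; exact (hb n).le⟩
    obtain ⟨n₀, hn₀⟩ := Nat.sSup_mem (Set.range_nonempty h) hbdd
    exact ⟨n₀, fun n hn => le_antisymm (hn₀ ▸ le_csSup hbdd ⟨n, rfl⟩) (hmono hn)⟩
  let g : ℕ → ℝ := fun n => condProb P (initSeg w.2 n) (initSeg w.1 (h n₀))
  have hanti : Antitone g := fun a b hab => condProb_mono P (initSeg_prefix _ hab) _
  have hbelow : BddBelow (Set.range g) :=
    ⟨0, by rintro _ ⟨n, rfl⟩; exact condProb_nonneg P _ _⟩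
  have hlow : ∀ n, n₀ ≤ n → infCondProb P h w ≤ g n := fun n hn => by
    have := infCondProb_le P h w n
    rwa [hn₀ n hn] at this
  have hα : 0 < ⨅ n, g n := hinf.trans_le <| le_ciInf fun n =>
    (hlow (max n n₀) (le_max_right _ _)).trans (hanti (le_max_left _ _))
  obtain ⟨c, hc1, hc2⟩ := exists_rat_btwn (show (3 / 4) * (⨅ n, g n) < ⨅ n, g n by linarith)
  obtain ⟨N, hN⟩ := exists_lt_of_ciInf_lt (show (⨅ n, g n) < (3 / 2) * ⨅ n, g n by linarith)
  refine ⟨max N n₀, c, ?_, ?_, ?_⟩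
  · have : (0 : ℝ) < c := by linarith
    exact_mod_cast this
  · intro n hn
    rw [hn₀ n (le_of_max_le_right hn)]
    exact hc2.trans_le (ciInf_le hbelow n)
  · intro n hn
    rw [hn₀ n (le_of_max_le_right hn)]
    have := hanti (le_max_left N n₀)
    change g (max N n₀) < _
    linarith

theorem exists_majority_of_unbounded {P : Measure (Seq × Seq)} [IsProbabilityMeasure P]
    {h : ℕ → ℕ} (hmono : Monotone h) (hunb : ∀ m, ∃ n, m ≤ h n) (w : Seq × Seq) {f : ℕ → ℚ}
    (hf1 : ∀ n, f n < 1) (hf : Summable fun n => (f n : ℝ)) (hconv : EffectivelyConverges P f h w)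
    (hinf : 0 < infCondProb P h w) :
    ∃ (N : ℕ) (c : ℚ), 0 < c ∧
      (∀ n, N ≤ n → (c : ℝ) < condProb P (initSeg w.2 n) (initSeg w.1 (h n))) ∧
      ∀ n, N ≤ n → condProb P (initSeg w.2 N) (initSeg w.1 (h n)) < 2 * (c : ℝ) := by
  have h1 : ∀ n, ∃ L : ℝ, HasCondLimit P (initSeg w.2 n) w.1 L ∧ L ≠ 0 ∧
      |condProb P (initSeg w.2 n) (initSeg w.1 (h n)) / L - 1| < (f n : ℝ) := fun n => by
    simpa using hconv _ (mem_matchedAlong_iff.2 ⟨n, rfl⟩)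
  choose L hlim hne hlt using h1
  have hpos : ∀ n, 0 < L n := fun n => lt_of_le_of_ne
    (ge_of_tendsto' (hlim n) fun _ => condProb_nonneg P _ _) (hne n).symm
  have hanti : Antitone L := fun a b hab =>
    le_of_tendsto_of_tendsto' (hlim b) (hlim a) fun _ => condProb_mono P (initSeg_prefix _ hab) _
  have hbound : ∀ n, (1 - (f n : ℝ)) * L n < condProb P (initSeg w.2 n) (initSeg w.1 (h n)) ∧
      condProb P (initSeg w.2 n) (initSeg w.1 (h n)) < (1 + (f n : ℝ)) * L n := fun n => by
    have h2 := abs_lt.1 (hlt n)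
    rw [← lt_div_iff₀ (hpos n), ← div_lt_iff₀ (hpos n)]
    constructor <;> linarith [h2.1, h2.2]
  -- Since `f n < 1`, the conditional probability is below `2 * L n`.
  have hα : 0 < ⨅ n, L n := by
    refine (half_pos hinf).trans_le (le_ciInf fun n => ?_)
    have h2 := infCondProb_le P h w n
    have h3 : (f n : ℝ) < 1 := by exact_mod_cast hf1 n
    nlinarith [(hbound n).2, hpos n]
  have hbelow : BddBelow (Set.range L) := ⟨0, by rintro _ ⟨n, rfl⟩; exact (hpos n).le⟩
  set α := ⨅ n, L n
  -- Once `f n < 1 / 8`, the lower bound is `(7 / 8) * α > c`, while the upper bound `(3 / 2) * α`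
  -- is below `2 * c`.
  obtain ⟨c, hc1, hc2⟩ := exists_rat_btwn (show (3 / 4) * α < (7 / 8) * α by linarith)
  obtain ⟨N₀, hN₀⟩ := exists_lt_of_ciInf_lt (show (⨅ n, L n) < (3 / 2) * α by linarith)
  have hh : Tendsto h atTop atTop := tendsto_atTop_atTop_of_monotone hmono hunb
  have hev : ∀ᶠ n in atTop, condProb P (initSeg w.2 N₀) (initSeg w.1 (h n)) < (3 / 2) * α :=
    ((hlim N₀).comp hh).eventually_lt_const hN₀
  have hevf : ∀ᶠ n in atTop, (f n : ℝ) < 1 / 8 :=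
    hf.tendsto_atTop_zero.eventually_lt_const (by norm_num)
  obtain ⟨N₁, hN₁⟩ := eventually_atTop.1 (hev.and hevf)
  refine ⟨max N₀ N₁, c, ?_, ?_, ?_⟩
  · have : (0 : ℝ) < c := by linarith
    exact_mod_cast this
  · intro n hn
    have h2 := (hN₁ n (le_of_max_le_right hn)).2
    have h3 : α ≤ L n := ciInf_le hbelow n
    nlinarith [(hbound n).1]
  · intro n hn
    have h2 := (hN₁ n (le_of_max_le_right hn)).1
    have h3 := condProb_mono P (initSeg_prefix w.2 (le_max_left N₀ N₁)) (initSeg w.1 (h n))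
    linarith

/-! ### Random pairs whose second sequence cannot be recovered -/

theorem exists_notMem_covered {P : Measure (Seq × Seq)} {V : Set (ℕ × (Word × Word))}
    (hV : IsTest P V) {w : Seq × Seq} (hw : w ∈ randomSet P) : ∃ n, w ∉ covered V n := by
  obtain ⟨U, ⟨-, hU⟩, hwU⟩ := hw
  by_contra! hcon
  obtain ⟨c, hc⟩ := hU V hV
  exact hwU (Set.mem_iInter.2 fun n => hc n (hcon (n + c)))

/-- A null cylinder, repeated at every level, is a test. Positivity ensures that a small `condProb`
is a genuine quotient and not the default value `0`. -/
theorem real_cyl₂_pos {P : Measure (Seq × Seq)} {w : Seq × Seq} (hw : w ∈ randomSet P) (n : ℕ) :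
    0 < P.real (cyl₂ (initSeg w.1 n) []) := by
  by_contra hcon
  have h0 : P.real (cyl₂ (initSeg w.1 n) []) = 0 := le_antisymm (not_lt.1 hcon) measureReal_nonneg
  let V : Set (ℕ × (Word × Word)) := {q | q.2 = (initSeg w.1 n, [])}
  have hcov : ∀ k, covered V k = cyl₂ (initSeg w.1 n) [] := by
    intro k
    ext v
    simp [covered, V]
  have hV : IsTest P V :=
    { re := rePred_of_computable_eq Computable.snd (Computable.const _)
      anti := fun k => by rw [hcov, hcov]
      small := fun k => by rw [hcov, h0]; positivity }
  obtain ⟨k, hk⟩ := exists_notMem_covered hV hw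
  rw [hcov] at hk
  exact hk ⟨isPrefixOf_initSeg _ _, by simp⟩

theorem real_iUnion_cyl₂_le {P : Measure (Seq × Seq)} [IsProbabilityMeasure P] {h : ℕ → ℕ}
    (hmono : Monotone h) {E : Set (Word × Word)} {ε : ℝ} (hε : 0 ≤ ε)
    (hE : ∀ q ∈ E, q.1.length = h q.2.length ∧
      P.real (cyl₂ q.1 q.2) ≤ ε * P.real (cyl₂ q.1 []))
    (hcoh : ∀ q ∈ E, ∀ q' ∈ E, q.1 <+: q'.1 → (q.2 <+: q'.2 ∨ q'.2 <+: q.2)) :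
    P.real (⋃ q ∈ E, cyl₂ q.1 q.2) ≤ ε := by
  -- The minimal rectangles cover the union, and `hinc` shows that their first components are
  -- pairwise incomparable.
  let M : Set (Word × Word) := {q ∈ E | ∀ q' ∈ E, q'.1 <+: q.1 → q'.2 <+: q.2 → q' = q}
  have hmin : ∀ k, ∀ q ∈ E, q.1.length + q.2.length ≤ k →
      ∃ q' ∈ M, q'.1 <+: q.1 ∧ q'.2 <+: q.2 := by
    intro k
    induction k with
    | zero =>
      intro q hq hk
      refine ⟨q, ⟨hq, fun q' _ h1 h2 => Prod.ext ?_ ?_⟩, List.prefix_refl _, List.prefix_refl _⟩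
      · exact h1.eq_of_length_le (by omega)
      · exact h2.eq_of_length_le (by omega)
    | succ k ih =>
      intro q hq hk
      by_cases hqM : q ∈ M
      · exact ⟨q, hqM, List.prefix_refl _, List.prefix_refl _⟩
      · have : ∃ q' ∈ E, q'.1 <+: q.1 ∧ q'.2 <+: q.2 ∧ q' ≠ q := by
          by_contra! hcon
          exact hqM ⟨hq, hcon⟩
        obtain ⟨q', hq', h1, h2, hne⟩ := this
        have hlt : q'.1.length + q'.2.length < q.1.length + q.2.length := by
          by_contra hge
          have := h1.length_le
          have := h2.length_le
          exact hne (Prod.ext (h1.eq_of_length_le (by omega)) (h2.eq_of_length_le (by omega)))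
        obtain ⟨q'', hq'', h3, h4⟩ := ih q' hq' (by omega)
        exact ⟨q'', hq'', h3.trans h1, h4.trans h2⟩
  have hsub : (⋃ q ∈ E, cyl₂ q.1 q.2) ⊆ ⋃ q : M, cyl₂ q.1.1 q.1.2 := by
    refine Set.iUnion₂_subset fun q hq => ?_
    obtain ⟨q', hq', h1, h2⟩ := hmin _ q hq le_rfl
    exact (cyl₂_subset h1 h2).trans (Set.subset_iUnion (fun q : M => cyl₂ q.1.1 q.1.2) ⟨q', hq'⟩)
  have hinc : ∀ q ∈ M, ∀ q' ∈ M, q.1 <+: q'.1 → q = q' := by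
    intro q hq q' hq' hpre
    rcases hcoh q hq.1 q' hq'.1 hpre with h1 | h1
    -- If the second components are nested the other way, monotonicity of `h` forces equal first
    -- components, and minimality of `q` applies.
    · exact hq'.2 q hq.1 hpre h1
    · have hl : q'.1.length ≤ q.1.length := by
        rw [(hE q hq.1).1, (hE q' hq'.1).1]
        exact hmono h1.length_le
      have heq := hpre.eq_of_length_le hl
      exact (hq.2 q' hq'.1 (heq ▸ List.prefix_refl _) h1).symm
  have hdisj : Pairwise (Function.onFun Disjoint fun q : M => cyl₂ q.1.1 []) := by
    intro q q' hne
    refine Set.disjoint_prod.2 (Or.inl ?_)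
    rcases le_total q.1.1.length q'.1.1.length with hl | hl
    · exact disjoint_cyl hl fun hpre => hne (Subtype.ext (hinc _ q.2 _ q'.2 hpre))
    · exact (disjoint_cyl hl fun hpre =>
        hne (Subtype.ext (hinc _ q'.2 _ q.2 hpre)).symm).symm
  refine ENNReal.toReal_le_of_le_ofReal hε ?_
  calc P (⋃ q ∈ E, cyl₂ q.1 q.2)
      ≤ P (⋃ q : M, cyl₂ q.1.1 q.1.2) := measure_mono hsub
    _ ≤ ∑' q : M, P (cyl₂ q.1.1 q.1.2) := measure_iUnion_le _
    _ ≤ ∑' q : M, ENNReal.ofReal ε * P (cyl₂ q.1.1 []) := by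
        refine ENNReal.tsum_le_tsum fun q => ?_
        have h1 := ENNReal.ofReal_le_ofReal (hE q.1 q.2.1).2
        rwa [ENNReal.ofReal_mul hε, ofReal_measureReal, ofReal_measureReal] at h1
    _ = ENNReal.ofReal ε * P (⋃ q : M, cyl₂ q.1.1 []) := by
        rw [ENNReal.tsum_mul_left, measure_iUnion hdisj fun q => measurableSet_cyl₂ _ _]
    _ ≤ ENNReal.ofReal ε * 1 := by gcongr; exact prob_le_one
    _ = ENNReal.ofReal ε := mul_one _

theorem not_exists_isComputableMonotone {P : Measure (Seq × Seq)} [IsProbabilityMeasure P]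
    (hP : IsComputableMeasure P) {h : ℕ → ℕ} (hmono : Monotone h) (hcomp : Computable h)
    {w : Seq × Seq} (hw : w ∈ randomSet P) (hinf : infCondProb P h w = 0) :
    ¬ ∃ ρ : Str → Str, IsComputableMonotone ρ ∧
      ∀ q ∈ matchedAlong h w, Str.fin q.2 ≤ ρ (Str.fin q.1) := by
  rintro ⟨ρ, ⟨F, hF, hF0, hρ⟩, hle⟩
  -- The exponent `n + 1` turns the non-strict measure bound into the strict one required of a test.
  -- The last clause is an r.e. witness of `y ⊑ ρ(x)`.
  let U : Set (ℕ × (Word × Word)) := {q | q.2.1.length = h q.2.2.length ∧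
    ((2 ^ (q.1 + 1) : ℕ) : ℝ) * P.real (cyl₂ q.2.1 q.2.2) <
      ((1 : ℕ) : ℝ) * P.real (cyl₂ q.2.1 []) ∧
    ∃ r : Word × Word, r ∈ F ∧ r.1 <+: q.2.1 ∧ q.2.2 <+: r.2}
  have hcov : ∀ n, covered U n = ⋃ q ∈ {q | (n, q) ∈ U}, cyl₂ q.1 q.2 := by
    intro n
    ext v
    simp only [covered, Set.mem_ofPred_eq, Set.mem_iUnion, Prod.exists, exists_prop]
  have hsmall : ∀ n, P.real (covered U n) ≤ (2 : ℝ)⁻¹ ^ (n + 1) := by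
    intro n
    rw [hcov]
    refine real_iUnion_cyl₂_le hmono (by positivity) ?_ ?_
    · rintro q ⟨h1, h2, -⟩
      refine ⟨h1, ?_⟩
      simp only at h2
      push_cast at h2
      rw [inv_pow, inv_mul_eq_div, le_div_iff₀ (by positivity)]
      linarith
    · rintro q ⟨-, -, r, hr, hr1, hr2⟩ q' ⟨-, -, r', hr', hr1', hr2'⟩ hpre
      have hb : ∀ {s y : Word × Word}, s ∈ F → s.1 <+: q'.1 → y.2 <+: s.2 →
          Str.fin y.2 ≤ ρ (Str.fin q'.1) := fun {s y} hs hs1 hs2 =>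
        le_trans (b := Str.fin s.2) hs2 ((hρ (Str.fin q'.1)).1 ⟨s.1, s.2, hs1, hs, rfl⟩)
      exact Str.prefix_or_prefix (hb hr (hr1.trans hpre) hr2) (hb hr' hr1' hr2')
  have hU : IsTest P U := by
    refine ⟨?_, ?_, fun n => (hsmall n).trans_lt ?_⟩
    · refine rePred_and ?_ (rePred_and ?_ ?_)
      · exact rePred_of_computable_eq
          (Computable.list_length.comp (Computable.fst.comp Computable.snd))
          (hcomp.comp (Computable.list_length.comp (Computable.snd.comp Computable.snd)))
      · have hpow : Computable fun q : ℕ × (Word × Word) => 2 ^ (q.1 + 1) := by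
          have h1 : Computable fun k : ℕ => 2 ^ k :=
            (Computable.nat_rec (f := fun k : ℕ => k) (g := fun _ => 1)
              (h := fun _ r => 2 * r.2) Computable.id (Computable.const 1)
              (Computable₂.comp Primrec.nat_mul.to_comp (Computable.const 2)
                (Computable.snd.comp Computable.snd))).of_eq fun k => by
              induction k with
              | zero => rfl
              | succ k ih => rw [pow_succ', ← ih]
          exact h1.comp (Computable.succ.comp Computable.fst)
        exact rePred_measure_lt hP (i := fun q : ℕ × (Word × Word) => 2 ^ (q.1 + 1))
          (j := fun _ => 1) (u := fun q => (q.2.1, q.2.2)) (v := fun q => (q.2.1, [])) hpow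
          (Computable.const 1) Computable.snd
          ((Computable.fst.comp Computable.snd).pair (Computable.const []))
      · refine rePred_exists (p := fun u : (ℕ × (Word × Word)) × (Word × Word) =>
          u.2 ∈ F ∧ u.2.1 <+: u.1.2.1 ∧ u.1.2.2 <+: u.2.2)
          (rePred_and (rePred_comp hF Computable.snd) (rePred_and ?_ ?_))
        · exact rePred_prefix (Computable.fst.comp Computable.snd)
            (Computable.fst.comp (Computable.snd.comp Computable.fst))
        · exact rePred_prefix (Computable.snd.comp (Computable.snd.comp Computable.fst))
            (Computable.snd.comp Computable.snd)
    · rintro n v ⟨x, y, ⟨h1, h2, h3⟩, hv⟩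
      refine ⟨x, y, ⟨h1, lt_of_le_of_lt ?_ h2, h3⟩, hv⟩
      refine mul_le_mul_of_nonneg_right ?_ measureReal_nonneg
      exact_mod_cast Nat.pow_le_pow_right two_pos (Nat.le_succ _)
    · exact pow_lt_pow_right_of_lt_one₀ (by norm_num) (by norm_num) (Nat.lt_succ_self n)
  obtain ⟨n, hn⟩ := exists_notMem_covered hU hw
  obtain ⟨m, hm⟩ := exists_condProb_lt P (h := h) (w := w) (ε := (2 : ℝ)⁻¹ ^ (n + 1))
    (by rw [hinf]; positivity)
  have h1 := condProb_lt P (real_cyl₂_pos hw _) hm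
  have hset : {t : Str | ∃ p' x : Word, Str.fin p' ≤ Str.fin (initSeg w.1 (h m)) ∧
      (p', x) ∈ F ∧ t = .fin x} =
      Str.fin '' {x | ∃ p', p' <+: initSeg w.1 (h m) ∧ (p', x) ∈ F} := by
    ext t
    constructor
    · rintro ⟨p', x, h1, h2, rfl⟩
      exact ⟨x, ⟨p', h1, h2⟩, rfl⟩
    · rintro ⟨x, ⟨p', h1, h2⟩, rfl⟩
      exact ⟨p', x, h1, h2, rfl⟩
  have hlub := hρ (Str.fin (initSeg w.1 (h m)))
  rw [hset] at hlub
  -- Compactness turns `y ⊑ ρ(x)` into a single pair of `F`, which puts the random pair in level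
  -- `n`.
  obtain ⟨z, ⟨p', hp', hz⟩, hyz⟩ := Str.exists_prefix_of_le_isLUB
    (T := {x | ∃ p', p' <+: initSeg w.1 (h m) ∧ (p', x) ∈ F}) ⟨[], List.nil_prefix, (hF0 []).1⟩
    hlub (hle _ (mem_matchedAlong_iff.2 ⟨m, rfl⟩))
  refine hn ⟨initSeg w.1 (h m), initSeg w.2 m, ⟨by simp, ?_, (p', z), hz, hp', hyz⟩,
    isPrefixOf_initSeg _ _, isPrefixOf_initSeg _ _⟩
  rw [inv_pow, inv_mul_eq_div, lt_div_iff₀ (by positivity)] at h1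
  push_cast
  linarith

end AlgRand

/-! ### Assembly of the three claims -/

theorem mainTheorem7
    (P : MeasureTheory.Measure (AlgRand.Seq × AlgRand.Seq)) [MeasureTheory.IsProbabilityMeasure P]
    (hP : AlgRand.IsComputableMeasure P)
    (h : ℕ → ℕ) (hmono : Monotone h) (hcomp : Computable h)
    (xinf yinf : AlgRand.Seq) :
    -- (a)
    ((∀ m : ℕ, ∃ n : ℕ, m ≤ h n) →
      0 < AlgRand.infCondProb P h (xinf, yinf) →
      ∃ ρ : AlgRand.Word →. AlgRand.Word, Partrec ρ ∧
        {q ∈ AlgRand.matchedAlong h (xinf, yinf) | q.2 ∈ ρ q.1}.Infinite) ∧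
    -- (b)
    (∀ f : ℕ → ℚ, (∀ n, 0 < f n ∧ f n < 1) → Summable (fun n => (f n : ℝ)) →
      (xinf, yinf) ∈ AlgRand.randomSet P →
      AlgRand.EffectivelyConverges P f h (xinf, yinf) →
      0 < AlgRand.infCondProb P h (xinf, yinf) →
      ∃ ρ : AlgRand.Str → AlgRand.Str, AlgRand.IsComputableMonotone ρ ∧
        ∀ q ∈ AlgRand.matchedAlong h (xinf, yinf),
          AlgRand.Str.fin q.2 ≤ ρ (AlgRand.Str.fin q.1)) ∧
    -- (c)
    ((xinf, yinf) ∈ AlgRand.randomSet P →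
      AlgRand.infCondProb P h (xinf, yinf) = 0 →
      ¬ ∃ ρ : AlgRand.Str → AlgRand.Str, AlgRand.IsComputableMonotone ρ ∧
        ∀ q ∈ AlgRand.matchedAlong h (xinf, yinf),
          AlgRand.Str.fin q.2 ≤ ρ (AlgRand.Str.fin q.1)) := by
  refine ⟨fun hunb hinf => AlgRand.exists_partrec_matchedAlong hP hcomp hunb _ hinf, ?_,
    fun hw hinf => AlgRand.not_exists_isComputableMonotone hP hmono hcomp hw hinf⟩
  intro f hf hsum _ hconv hinf
  obtain ⟨N, c, hc, hlow, hup⟩ : ∃ (N : ℕ) (c : ℚ), 0 < c ∧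
      (∀ n, N ≤ n → (c : ℝ) <
        AlgRand.condProb P (AlgRand.initSeg yinf n) (AlgRand.initSeg xinf (h n))) ∧
      ∀ n, N ≤ n →
        AlgRand.condProb P (AlgRand.initSeg yinf N) (AlgRand.initSeg xinf (h n)) < 2 * (c : ℝ) := by
    -- Only for unbounded `h` do the prefixes of length `h n` approach the limit along `xinf`.
    by_cases hunb : ∀ m, ∃ n, m ≤ h n
    · exact AlgRand.exists_majority_of_unbounded hmono hunb (xinf, yinf) (fun n => (hf n).2) hsum
        hconv hinf
    · push Not at hunb
      obtain ⟨m, hm⟩ := hunb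
      exact AlgRand.exists_majority_of_bounded hmono hm (xinf, yinf) hinf
  exact AlgRand.exists_isComputableMonotone_of_majority hP hmono hcomp (xinf, yinf) N hc hlow hup
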